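/- Let $0\le n\le N$ be integers and put $M=N-n$. Let $w:\mathbb R\to[0,\infty)$ be a weight function that is not almost everywhere zero and whose moments $\int_{\mathbb R} z^k w(z)\,dz$ are finite (absolutely convergent) for $0\le k\le 2N-2$ (and for $k=0$). Let $P_j$ ($0\le j<N$) be the monic orthogonal polynomials for $w$, $h_j=\int_{\mathbb R} P_j(z)^2 w(z)\,dz$, and let $$K_N(a;b)=\sum_{j=0}^{N-1}\frac{P_j(a)P_j(b)}{h_j}$$ be the Christoffel–Darboux kernel. With $\Delta_m(u)=\prod_{1\le i<j\le m}(u_j-u_i)$, let $$\widehat K_N^{(n)}(x;y)=\frac{\prod_{j=N-n}^{N-1}h_j}{\prod_{i=1}^n (x_iy_i)^{N-n}}\cdot\frac{\det_{1\le i,j\le n}K_N(x_i;y_j)}{\Delta_n(x)\,\Delta_n(y)}$$ be the normalized multi-point kernel, for complex (in particular, real) nonzero $x_1,\dots,x_n$ that are pairwise distinct and nonzero $y_1,\dots,y_n$ that are pairwise distinct. Let $t=(-1/x_1,\dots,-1/x_n,-1/y_1,\dots,-1/y_n)$, let $\mathbb Y_{2n,M}$ be the finite set of partitions $\lambda$ with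 at most $2n$ nonzero parts and $\lambda_1\le M$, let $\lambda'$ be the transposed partition, let $s_\lambda$ be the Schur polynomial, and let $$\langle s_\mu\rangle_w=\frac{1}{M!\,\mathcal Z_M}\int_{\mathbb R^M}\Delta_M(z)^2\,s_\mu(z_1,\dots,z_M)\prod_{j=1}^M w(z_j)\,dz_j,\qquad \mathcal Z_M=\frac1{M!}\int_{\mathbb R^M}\Delta_M(z)^2\prod_{j=1}^M w(z_j)\,dz_j,$$ be the average over the $M$-variable ensemble with weight $w$. Then $$\widehat K_N^{(n)}(x_1,\dots,x_n;y_1,\dots,y_n)=\sum_{\lambda\in\mathbb Y_{2n,N-n}} s_\lambda(t)\,\langle s_{\lambda'}\rangle_w .$$ Moreover, for arbitrary nonzero complex $x_1,\dots,x_n,y_1,\dots,y_n$, possibly with coincidences, the same identity holds with the left-hand side understood as the limit of $\widehat K_N^{(n)}(\tilde x;\tilde y)$ as $(\tilde x,\tilde y)\to(x,y)$ through points with pairwise distinct $\tilde x_i$ and pairwise distinct $\tilde y_i$. -/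

import Mathlib

open MeasureTheory Filter Topology

noncomputable section

namespace CDSchur

/-! ### Orthogonal polynomials and Christoffel-Darboux kernels -/

/-- The pairing `⟨p, q⟩_w = ∫ p(z) q(z) w(z) dz` over the real line. -/
def innerW (w : ℝ → ℝ) (p q : Polynomial ℝ) : ℝ :=
  ∫ z : ℝ, p.eval z * q.eval z * w z

/-- The monic orthogonal polynomial `P_k` of degree `k` for the weight `w`, built by the
Gram-Schmidt recursion `P_k = X^k - ∑_{j<k} ⟨X^k, P_j⟩_w / ⟨P_j, P_j⟩_w * P_j`. -/
def orthoPoly (w : ℝ → ℝ) (k : ℕ) : Polynomial ℝ :=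
  Polynomial.X ^ k - ∑ j : Fin k,
    Polynomial.C (innerW w (Polynomial.X ^ k) (orthoPoly w j) /
      innerW w (orthoPoly w j) (orthoPoly w j)) * orthoPoly w j
termination_by k
decreasing_by all_goals exact j.isLt

/-- The squared norm `h_k = ⟨P_k, P_k⟩_w`. -/
def sqNorm (w : ℝ → ℝ) (k : ℕ) : ℝ :=
  innerW w (orthoPoly w k) (orthoPoly w k)

/-- The Christoffel-Darboux kernel `K_N(a; b) = ∑_{j<N} P_j(a) P_j(b) / h_j`. -/
def cdKernel (w : ℝ → ℝ) (N : ℕ) (a b : ℂ) : ℂ :=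
  ∑ j ∈ Finset.range N,
    Polynomial.aeval a (orthoPoly w j) * Polynomial.aeval b (orthoPoly w j) / (sqNorm w j : ℂ)

/-- The Vandermonde product `Δ_m(x) = ∏_{i<j} (x_j - x_i)`. -/
def vdm {R : Type*} [CommRing R] {m : ℕ} (x : Fin m → R) : R :=
  ∏ i : Fin m, ∏ j ∈ Finset.Ioi i, (x j - x i)

/-- The multi-point kernel `K_N^{(n)}(x; y) = det (K_N(x_i; y_j)) / (Δ_n(x) Δ_n(y))`
(meaningful for pairwise distinct `x_i` and pairwise distinct `y_i`). -/
def multiKernel (w : ℝ → ℝ) (N : ℕ) {n : ℕ} (x y : Fin n → ℂ) : ℂ :=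
  1 / (vdm x * vdm y) * (Matrix.of fun i j : Fin n => cdKernel w N (x i) (y j)).det

/-- The normalized multi-point kernel
`(∏_{j=N-n}^{N-1} h_j) / (∏_i (x_i y_i)^{N-n}) * K_N^{(n)}(x; y)`. -/
def hatKernel (w : ℝ → ℝ) (N : ℕ) {n : ℕ} (x y : Fin n → ℂ) : ℂ :=
  (∏ j ∈ Finset.Ico (N - n) N, (sqNorm w j : ℂ)) / (∏ i : Fin n, (x i * y i) ^ (N - n)) *
    multiKernel w N x y

/-- The vector `t = (-1/x_1, …, -1/x_n, -1/y_1, …, -1/y_n)`. -/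
def tVec {n : ℕ} (x y : Fin n → ℂ) : Fin (n + n) → ℂ :=
  Fin.append (fun i => -1 / x i) (fun i => -1 / y i)

/-! ### Ensemble averages -/

/-- The partition function `Z_M = (1/M!) ∫ Δ_M(z)^2 ∏_j w(z_j) dz_j`. -/
def partitionFn (w : ℝ → ℝ) (M : ℕ) : ℝ :=
  1 / (M.factorial : ℝ) * ∫ z : Fin M → ℝ, vdm z ^ 2 * ∏ j, w (z j)

/-- The average `⟨f⟩_w` of a function of the `M` variables of the ensemble with weight `w`,
with normalization `1 / (M! Z_M)`. -/
def ensembleAverage (w : ℝ → ℝ) (M : ℕ) (f : (Fin M → ℝ) → ℝ) : ℝ :=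
  1 / ((M.factorial : ℝ) * partitionFn w M) *
    ∫ z : Fin M → ℝ, vdm z ^ 2 * f z * ∏ j, w (z j)

/-! ### Schur polynomials -/

/-- The alternant `det (X_i ^ {e_j})`. -/
def alternant (m : ℕ) (e : Fin m → ℕ) : MvPolynomial (Fin m) ℤ :=
  (Matrix.of fun i j : Fin m => (MvPolynomial.X i : MvPolynomial (Fin m) ℤ) ^ e j).det

/-- The staircase `δ = (m-1, m-2, …, 0)`. -/
def stair (m : ℕ) (j : Fin m) : ℕ := m - 1 - j

/-- Every alternant is a multiple of the Vandermonde alternant `a_δ`. -/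
theorem alternant_stair_dvd (m : ℕ) (e : Fin m → ℕ) :
    alternant m (stair m) ∣ alternant m e := by
  classical
  let Q : Polynomial (MvPolynomial (Fin m) ℤ) :=
    ∏ i : Fin m, (Polynomial.X - Polynomial.C (MvPolynomial.X i))
  have hQ : Q.Monic := Polynomial.monic_prod_of_monic _ _ fun i _ => Polynomial.monic_X_sub_C _
  have hdeg : Q.natDegree = m := by
    simp [Q, Polynomial.natDegree_prod_of_monic, Polynomial.monic_X_sub_C]
  have hroot : ∀ i, Q.eval (MvPolynomial.X i) = 0 := by
    intro i
    simp only [Q, Polynomial.eval_prod]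
    exact Finset.prod_eq_zero (Finset.mem_univ i) (by simp)
  let R : Matrix (Fin m) (Fin m) (MvPolynomial (Fin m) ℤ) :=
    Matrix.of fun k j => ((Polynomial.X ^ e j) %ₘ Q).coeff (stair m k)
  have key : (Matrix.of fun i j : Fin m =>
      (MvPolynomial.X i : MvPolynomial (Fin m) ℤ) ^ e j) =
      (Matrix.of fun i j : Fin m =>
        (MvPolynomial.X i : MvPolynomial (Fin m) ℤ) ^ stair m j) * R := by
    ext1 i j
    rw [Matrix.mul_apply]
    simp only [Matrix.of_apply, R]
    have hm : 0 < m := i.pos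
    have h1 : ((Polynomial.X ^ e j) %ₘ Q).eval (MvPolynomial.X i) =
        (MvPolynomial.X i : MvPolynomial (Fin m) ℤ) ^ e j := by
      have := congrArg (Polynomial.eval (MvPolynomial.X i))
        (Polynomial.modByMonic_add_div (Polynomial.X ^ e j) Q)
      simpa [hroot i] using this
    have hlt : ((Polynomial.X ^ e j) %ₘ Q).natDegree < m := by
      have := Polynomial.natDegree_modByMonic_lt (Polynomial.X ^ e j) hQ (by
        intro h
        rw [h] at hdeg
        simp at hdeg
        omega)
      omega
    rw [← h1, Polynomial.eval_eq_sum_range' hlt, ← Fin.sum_univ_eq_sum_range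
      (fun k => ((Polynomial.X ^ e j) %ₘ Q).coeff k * (MvPolynomial.X i) ^ k) m,
      ← Equiv.sum_comp Fin.revPerm]
    refine Finset.sum_congr rfl fun k _ => ?_
    have : ((Fin.revPerm k : Fin m) : ℕ) = stair m k := by
      simp [Fin.revPerm, Fin.val_rev, stair]
      omega
    rw [this, mul_comm]
  refine ⟨R.det, ?_⟩
  rw [alternant, alternant, key, Matrix.det_mul]

/-- The Schur polynomial `s_l = a_{l+δ} / a_δ` in `m` variables (zero if `l` has more than
`m` rows). -/
def schurPoly (m : ℕ) (l : YoungDiagram) : MvPolynomial (Fin m) ℤ :=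
  if l.colLen 0 ≤ m then
    Classical.choose (alternant_stair_dvd m fun j => l.rowLen j + stair m j)
  else 0

/-- The quotient is the defining one. -/
theorem alternant_stair_mul_schurPoly (m : ℕ) (l : YoungDiagram) (hl : l.colLen 0 ≤ m) :
    alternant m (stair m) * schurPoly m l = alternant m fun j => l.rowLen j + stair m j := by
  rw [schurPoly, if_pos hl]
  exact (Classical.choose_spec
    (alternant_stair_dvd m fun j => l.rowLen j + stair m j)).symm

/-- The value `s_l(z_1, …, z_m)` of a Schur polynomial. -/
def schur {R : Type*} [CommRing R] {m : ℕ} (l : YoungDiagram) (z : Fin m → R) : R :=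
  MvPolynomial.aeval z (schurPoly m l)

/-! ### Partitions in a rectangle -/

theorem finite_boundedPartitions (L M : ℕ) :
    {l : YoungDiagram | l.colLen 0 ≤ L ∧ l.rowLen 0 ≤ M}.Finite := by
  classical
  refine Set.Finite.of_finite_image (f := YoungDiagram.cells) ?_ ?_
  · refine ((Finset.range L ×ˢ Finset.range M).powerset.finite_toSet).subset ?_
    rintro _ ⟨l, ⟨h1, h2⟩, rfl⟩
    simp only [Finset.mem_coe, Finset.mem_powerset]
    rintro ⟨i, j⟩ hc
    rw [YoungDiagram.mem_cells] at hc
    have hi := YoungDiagram.mem_iff_lt_colLen.1 (l.up_left_mem le_rfl (Nat.zero_le j) hc)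
    have hj := YoungDiagram.mem_iff_lt_rowLen.1 (l.up_left_mem (Nat.zero_le i) le_rfl hc)
    simp only [Finset.mem_product, Finset.mem_range]
    omega
  · intro a _ b _ h
    exact YoungDiagram.ext h

/-- The set `𝕐_{L,M}` of partitions with at most `L` rows and with all parts at most `M`. -/
def boundedPartitions (L M : ℕ) : Finset YoungDiagram :=
  (finite_boundedPartitions L M).toFinset

/-! ### The recursion produces the monic orthogonal polynomials -/

theorem orthoPoly_monic_natDegree (w : ℝ → ℝ) (k : ℕ) :
    (orthoPoly w k).Monic ∧ (orthoPoly w k).natDegree = k := by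
  induction k using Nat.strong_induction_on with
  | _ k ih =>
    have hd : (∑ j : Fin k, Polynomial.C (innerW w (Polynomial.X ^ k) (orthoPoly w j) /
        innerW w (orthoPoly w j) (orthoPoly w j)) * orthoPoly w j).degree < (k : WithBot ℕ) := by
      rw [← Polynomial.mem_degreeLT]
      refine Submodule.sum_mem _ fun j _ => ?_
      rw [Polynomial.mem_degreeLT, ← Polynomial.smul_eq_C_mul]
      refine (Polynomial.degree_smul_le _ _).trans_lt ?_
      refine Polynomial.degree_le_natDegree.trans_lt ?_
      rw [(ih j j.isLt).2]
      exact_mod_cast j.isLt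
    rw [orthoPoly]
    refine ⟨(Polynomial.monic_X_pow k).sub_of_left (by simpa using hd), ?_⟩
    refine Polynomial.natDegree_eq_of_degree_eq_some ?_
    rw [Polynomial.degree_sub_eq_left_of_degree_lt (by simpa using hd), Polynomial.degree_X_pow]

theorem integrable_eval_mul (w : ℝ → ℝ) (d : ℕ)
    (hw : ∀ k ≤ d, Integrable (fun z : ℝ => z ^ k * w z)) (p : Polynomial ℝ)
    (hp : p.natDegree ≤ d) : Integrable (fun z : ℝ => p.eval z * w z) := by
  have h : (fun z : ℝ => p.eval z * w z) =
      fun z : ℝ => ∑ k ∈ Finset.range (p.natDegree + 1), p.coeff k * (z ^ k * w z) := by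
    funext z
    rw [Polynomial.eval_eq_sum_range, Finset.sum_mul]
    exact Finset.sum_congr rfl fun k _ => by ring
  rw [h]
  refine integrable_finsetSum _ fun k hk => (hw k ?_).const_mul _
  have := Finset.mem_range.1 hk
  omega

/-- Positivity of the pairing on nonzero polynomials of degree below `N`. -/
theorem innerW_self_pos (w : ℝ → ℝ) (N : ℕ) (hw_nonneg : ∀ z, 0 ≤ w z)
    (hw_ne : ¬ w =ᵐ[volume] 0)
    (hw_moments : ∀ k ≤ 2 * (N - 1), Integrable (fun z : ℝ => z ^ k * w z))
    (p : Polynomial ℝ) (hp0 : p ≠ 0) (hp : p.natDegree < N) : 0 < innerW w p p := by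
  have hnn : ∀ z, 0 ≤ p.eval z * p.eval z * w z := fun z =>
    mul_nonneg (mul_self_nonneg _) (hw_nonneg z)
  have hi : Integrable (fun z : ℝ => p.eval z * p.eval z * w z) := by
    have := integrable_eval_mul w _ hw_moments (p * p)
      (Polynomial.natDegree_mul_le.trans (by omega))
    simpa using this
  refine lt_of_le_of_ne (integral_nonneg hnn) fun h => hw_ne ?_
  have h0 := (integral_eq_zero_iff_of_nonneg hnn hi).1 h.symm
  have hr : ∀ᵐ z : ℝ, p.eval z ≠ 0 := by
    have hfin : {z : ℝ | p.eval z = 0}.Finite := by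
      refine (p.roots.toFinset.finite_toSet).subset fun z hz => ?_
      simpa [hp0] using hz
    simpa [ae_iff] using hfin.measure_zero volume
  filter_upwards [h0, hr] with z hz hz'
  simpa [hz'] using hz

/-- The polynomials `P_0, …, P_{N-1}` are pairwise orthogonal with positive norms, for every
nonnegative weight that is not almost everywhere zero and has finite moments up to `2N - 2`. -/
theorem orthoPoly_orthogonal (w : ℝ → ℝ) (N : ℕ) (hw_nonneg : ∀ z, 0 ≤ w z)
    (hw_ne : ¬ w =ᵐ[volume] 0)
    (hw_moments : ∀ k ≤ 2 * (N - 1), Integrable (fun z : ℝ => z ^ k * w z))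
    (k : ℕ) (hk : k < N) :
    0 < sqNorm w k ∧ ∀ j < k, innerW w (orthoPoly w k) (orthoPoly w j) = 0 := by
  refine ⟨innerW_self_pos w N hw_nonneg hw_ne hw_moments _ (orthoPoly_monic_natDegree w k).1.ne_zero
    (by rwa [(orthoPoly_monic_natDegree w k).2]), ?_⟩
  induction k using Nat.strong_induction_on with
  | _ k ih =>
    intro j hj
    have hint : ∀ p q : Polynomial ℝ, p.natDegree < N → q.natDegree < N →
        Integrable (fun z : ℝ => p.eval z * q.eval z * w z) := by
      intro p q hp hq
      have := integrable_eval_mul w _ hw_moments (p * q)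
        (Polynomial.natDegree_mul_le.trans (by omega))
      simpa using this
    have hdeg : ∀ i < N, (orthoPoly w i).natDegree < N := fun i hi => by
      rwa [(orthoPoly_monic_natDegree w i).2]
    have hexp : innerW w (orthoPoly w k) (orthoPoly w j) =
        innerW w (Polynomial.X ^ k) (orthoPoly w j) - ∑ i : Fin k,
          innerW w (Polynomial.X ^ k) (orthoPoly w i) / innerW w (orthoPoly w i) (orthoPoly w i) *
            innerW w (orthoPoly w i) (orthoPoly w j) := by
      conv_lhs => rw [orthoPoly]
      simp only [innerW, ← integral_const_mul]
      rw [← integral_finsetSum, ← integral_sub]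
      · congr 1
        funext z
        simp only [Polynomial.eval_sub, Polynomial.eval_finsetSum, Polynomial.eval_mul,
          Polynomial.eval_C, sub_mul, Finset.sum_mul, mul_assoc]
      · exact hint _ _ (by simpa using hk) (hdeg j (hj.trans hk))
      · exact integrable_finsetSum _ fun i _ =>
          (hint _ _ (hdeg i (i.isLt.trans hk)) (hdeg j (hj.trans hk))).const_mul _
      · exact fun i _ =>
          (hint _ _ (hdeg i (i.isLt.trans hk)) (hdeg j (hj.trans hk))).const_mul _
    rw [hexp, Finset.sum_eq_single (⟨j, hj⟩ : Fin k)]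
    · have hpos := innerW_self_pos w N hw_nonneg hw_ne hw_moments (orthoPoly w j)
        (orthoPoly_monic_natDegree w j).1.ne_zero (hdeg j (hj.trans hk))
      simp only
      rw [div_mul_cancel₀ _ hpos.ne', sub_self]
    · intro i _ hij
      have hne : (i : ℕ) ≠ j := fun h => hij (Fin.ext h)
      rcases lt_or_gt_of_ne hne with h | h
      · have := ih j hj (hj.trans hk) i h
        rw [show innerW w (orthoPoly w i) (orthoPoly w j) = 0 by
          rw [← this]; simp only [innerW]; congr 1; funext z; ring, mul_zero]
      · rw [ih i i.isLt (i.isLt.trans hk) j h, mul_zero]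
    · simp

end CDSchur

end

open CDSchur

/-! Write `N = M + n`. Multiplying the Vandermonde product of `z_1, …, z_M` by
`∏ (x_i - z_k)` and by the Vandermonde product of the `x_i` gives the Vandermonde product of all `N`
variables, which is the determinant of the monic polynomials `P_0, …, P_{N-1}` at these points. The
same holds for the `y_i`. The integral over `z` of the product of the two `N × N` determinants is
evaluated by orthogonality (Andréief's identity with extra constant rows,
`integral_det_bordered_of_orthogonal`) and equals `M! ∏_{j<N} h_j det K_N(x_i; y_j)`; the case
`n = 0` gives the partition function. Hence the normalized kernel is the average of
`∏ (1 - z_k / x_i) (1 - z_k / y_i) = ∏ (1 + t_i z_k)`, which the dual Cauchy identity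
(`prod_one_add_mul_eq_sum_schur`) turns into the Schur expansion.

The dual Cauchy identity itself is a Laplace expansion of one homogeneous Vandermonde determinant,
with a row `(t_i : 1)` for each `t_i` and a row `(1 : -z_k)` for each `z_k`. Its terms are indexed by
the partitions `l` in the rectangle, since the exponents `l_j + L - 1 - j` and `L + k - l'_k` are
complementary in `{0, …, L + M - 1}`; the sign of the corresponding shuffle is found by removing
boxes one at a time.

The statement at coinciding points follows from the one at distinct points, because the right hand
side is continuous at nonzero `x`, `y`. -/

namespace CDSchur

/-! ### Laplace expansion along a block of rows -/

/-- Laplace expansion of a determinant with respect to the rows `m`, where the `ρ i` represent the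
left cosets of `Perm m × Perm n` in `Perm (m ⊕ n)`. -/
theorem det_eq_sum_det_mul_det {R m n ι : Type*} [CommRing R] [Fintype m] [Fintype n] [Fintype ι]
    [DecidableEq m] [DecidableEq n] (ρ : ι → Equiv.Perm (m ⊕ n))
    (hinj : ∀ i j, ((ρ i)⁻¹ * ρ j) ∈ (Equiv.Perm.sumCongrHom m n).range → i = j)
    (hsurj : ∀ σ, ∃ i, ((ρ i)⁻¹ * σ) ∈ (Equiv.Perm.sumCongrHom m n).range)
    (A : Matrix (m ⊕ n) (m ⊕ n) R) :
    A.det = ∑ i, (Equiv.Perm.sign (ρ i) : R) *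
      (Matrix.of fun a b : m => A (.inl a) (ρ i (.inl b))).det *
      (Matrix.of fun a b : n => A (.inr a) (ρ i (.inr b))).det := by
  have hbij : Function.Bijective
      (fun p : ι × Equiv.Perm m × Equiv.Perm n => ρ p.1 * Equiv.Perm.sumCongr p.2.1 p.2.2) := by
    constructor
    · rintro ⟨i, α, β⟩ ⟨j, α', β'⟩ h
      simp only at h
      have hij : i = j := by
        refine hinj i j ⟨(α, β) * (α', β')⁻¹, ?_⟩
        rw [map_mul, map_inv]
        simp only [Equiv.Perm.sumCongrHom_apply]
        rw [mul_inv_eq_iff_eq_mul, mul_assoc, eq_inv_mul_iff_mul_eq]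
        exact h
      subst hij
      have := mul_left_cancel h
      have := Equiv.Perm.sumCongrHom_injective (α := m) (β := n) (a₁ := (α, β)) (a₂ := (α', β'))
        (by simpa using this)
      simp_all
    · intro σ
      obtain ⟨i, ⟨α, β⟩, h⟩ := hsurj σ
      refine ⟨⟨i, α, β⟩, ?_⟩
      simp only [Equiv.Perm.sumCongrHom_apply] at h
      simp only [h, mul_inv_cancel_left]
  rw [← Matrix.det_transpose, Matrix.det_apply', ← (Equiv.ofBijective _ hbij).sum_comp,
    Fintype.sum_prod_type]
  refine Finset.sum_congr rfl fun i _ => ?_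
  rw [← Matrix.det_transpose, Matrix.det_apply', ← Matrix.det_transpose, Matrix.det_apply',
    mul_assoc, Finset.sum_mul_sum, Finset.mul_sum, Fintype.sum_prod_type]
  refine Finset.sum_congr rfl fun α _ => ?_
  rw [Finset.mul_sum]
  refine Finset.sum_congr rfl fun β _ => ?_
  simp [Fintype.prod_sum_type, Equiv.Perm.sign_mul, Equiv.Perm.sign_sumCongr]
  ring

/-! ### Vandermonde products of concatenated variables -/

/-- A product over the pairs `i < j` of `Fin (L + M)` splits by the blocks that contain `i`, `j`. -/
theorem prod_Ioi_add {R : Type*} [CommMonoid R] {L M : ℕ} (f : Fin (L + M) → Fin (L + M) → R) :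
    ∏ i, ∏ j ∈ Finset.Ioi i, f i j =
      (∏ i : Fin L, ∏ j ∈ Finset.Ioi i, f (Fin.castAdd M i) (Fin.castAdd M j)) *
      (∏ i : Fin L, ∏ k : Fin M, f (Fin.castAdd M i) (Fin.natAdd L k)) *
      (∏ i : Fin M, ∏ j ∈ Finset.Ioi i, f (Fin.natAdd L i) (Fin.natAdd L j)) := by
  have h : ∀ {m : ℕ} (g : Fin m → Fin m → R) (i : Fin m),
      ∏ j ∈ Finset.Ioi i, g i j = ∏ j, if i < j then g i j else 1 := by
    intro m g i
    rw [← Finset.prod_filter]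
    congr 1
    ext j
    simp
  simp only [h f, h (fun i j => f (Fin.castAdd M i) (Fin.castAdd M j)),
    h (fun i j => f (Fin.natAdd L i) (Fin.natAdd L j)), Fin.prod_univ_add]
  have h1 : ∀ (i : Fin L) (k : Fin M), Fin.castAdd M i < Fin.natAdd L k := fun i k => by
    simp [Fin.lt_def]; omega
  have h2 : ∀ i j : Fin L, Fin.castAdd M i < Fin.castAdd M j ↔ i < j := fun _ _ => Iff.rfl
  simp only [Finset.prod_mul_distrib, h1, if_true, fun i k => not_lt_of_gt (h1 i k), if_false,
    Finset.prod_const_one, one_mul, h2, Fin.natAdd_lt_natAdd_iff]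

theorem vdm_eq_det {R : Type*} [CommRing R] {m : ℕ} (z : Fin m → R) :
    vdm z = (Matrix.vandermonde z).det := (Matrix.det_vandermonde z).symm

theorem vdm_append {R : Type*} [CommRing R] {L M : ℕ} (a : Fin L → R) (b : Fin M → R) :
    vdm (Fin.append a b) = vdm a * (∏ i, ∏ k, (b k - a i)) * vdm b := by
  simp [vdm, prod_Ioi_add]

theorem det_pow_stair {R : Type*} [CommRing R] {m : ℕ} (z : Fin m → R) :
    (Matrix.of fun i j : Fin m => z i ^ stair m j).det =
      (Equiv.Perm.sign (Fin.revPerm : Equiv.Perm (Fin m)) : R) * vdm z := by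
  rw [vdm_eq_det, ← Matrix.det_permute']
  congr 1
  ext i j
  simp [stair, Matrix.vandermonde_apply, Fin.val_rev]
  congr 1
  omega

theorem det_neg_pow_stair {R : Type*} [CommRing R] {m : ℕ} (z : Fin m → R) :
    (Matrix.of fun i j : Fin m => (-z i) ^ stair m j).det = vdm z := by
  have := Matrix.det_projVandermonde (1 : Fin m → R) (-z)
  simp only [Pi.one_apply, Pi.neg_apply, one_mul, sub_neg_eq_add, neg_add_eq_sub] at this
  rw [vdm, ← this]
  congr 1
  ext i j
  simp [stair, Matrix.projVandermonde_apply, Fin.val_rev]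
  congr 1
  omega

/-! ### Evaluating Schur polynomials -/

theorem aeval_alternant {R : Type*} [CommRing R] {m : ℕ} (e : Fin m → ℕ) (z : Fin m → R) :
    MvPolynomial.aeval z (alternant m e) = (Matrix.of fun i j : Fin m => z i ^ e j).det := by
  rw [alternant, AlgHom.map_det]
  congr 1
  ext i j
  simp

theorem det_pow_stair_mul_schur {R : Type*} [CommRing R] {m : ℕ} (l : YoungDiagram)
    (hl : l.colLen 0 ≤ m) (z : Fin m → R) :
    (Matrix.of fun i j : Fin m => z i ^ stair m j).det * schur l z =
      (Matrix.of fun i j : Fin m => z i ^ (l.rowLen j + stair m j)).det := by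
  rw [← aeval_alternant, schur, ← map_mul, alternant_stair_mul_schurPoly m l hl, aeval_alternant]

theorem map_schur {R S : Type*} [CommRing R] [CommRing S] (φ : R →+* S) {m : ℕ} (l : YoungDiagram)
    (z : Fin m → R) : φ (schur l z) = schur l (fun i => φ (z i)) := by
  have : (MvPolynomial.aeval (R := ℤ) fun i => φ (z i)) =
      (φ.toIntAlgHom).comp (MvPolynomial.aeval z) := by
    ext i
    simp
  rw [schur, schur, this]
  rfl

/-! ### The permutation attached to a partition in a rectangle -/

theorem mem_boundedPartitions {L M : ℕ} {l : YoungDiagram} :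
    l ∈ boundedPartitions L M ↔ l.colLen 0 ≤ L ∧ l.rowLen 0 ≤ M := by
  simp [boundedPartitions]

section Shuffle

variable {L M : ℕ}

/-- The exponents `l_j + L - 1 - j` and `L + k - l'_k`, which partition `{0, …, L + M - 1}` when
`l` fits in an `L × M` rectangle. -/
def shuffleVal (L M : ℕ) (l : YoungDiagram) : Fin L ⊕ Fin M → ℕ :=
  Sum.elim (fun j => l.rowLen j + stair L j) (fun k => L + k - l.colLen k)

theorem shuffleVal_lt {l : YoungDiagram} (hl : l ∈ boundedPartitions L M) (a : Fin L ⊕ Fin M) :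
    shuffleVal L M l a < L + M := by
  obtain ⟨h1, h2⟩ := mem_boundedPartitions.1 hl
  rcases a with j | k
  · have := l.rowLen_anti 0 j (Nat.zero_le _)
    simp only [shuffleVal, Sum.elim_inl, stair]
    omega
  · simp only [shuffleVal, Sum.elim_inr]
    omega

theorem rowLen_le_iff_colLen_le {l : YoungDiagram} {j k : ℕ} :
    l.rowLen j ≤ k ↔ l.colLen k ≤ j := by
  rw [← not_lt, ← not_lt, ← YoungDiagram.mem_iff_lt_rowLen, YoungDiagram.mem_iff_lt_colLen]

theorem shuffleVal_injective {l : YoungDiagram} (hl : l ∈ boundedPartitions L M) :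
    Function.Injective (shuffleVal L M l) := by
  obtain ⟨h1, h2⟩ := mem_boundedPartitions.1 hl
  have hlr : ∀ (j : Fin L) (k : Fin M), shuffleVal L M l (.inl j) ≠ shuffleVal L M l (.inr k) := by
    intro j k
    have h3 := l.colLen_anti 0 k (Nat.zero_le _)
    have h4 := rowLen_le_iff_colLen_le (l := l) (j := j) (k := k)
    simp only [shuffleVal, Sum.elim_inl, Sum.elim_inr, stair]
    omega
  rintro (i | i) (j | j) h
  · rcases lt_trichotomy i j with hij | hij | hij
    · have := l.rowLen_anti i j hij.le
      simp only [shuffleVal, Sum.elim_inl, stair] at h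
      omega
    · rw [hij]
    · have := l.rowLen_anti j i hij.le
      simp only [shuffleVal, Sum.elim_inl, stair] at h
      omega
  · exact absurd h (hlr _ _)
  · exact absurd h.symm (hlr _ _)
  · have h3 := l.colLen_anti 0 i (Nat.zero_le _)
    have h4 := l.colLen_anti 0 j (Nat.zero_le _)
    rcases lt_trichotomy i j with hij | hij | hij
    · have := l.colLen_anti i j hij.le
      simp only [shuffleVal, Sum.elim_inr] at h
      omega
    · rw [hij]
    · have := l.colLen_anti j i hij.le
      simp only [shuffleVal, Sum.elim_inr] at h
      omega

/-- The permutation of `Fin L ⊕ Fin M` given by `shuffleVal`, where the target `Fin L ⊕ Fin M` is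
identified with `{0, …, L + M - 1}`. -/
noncomputable def shuffle (l : boundedPartitions L M) : Equiv.Perm (Fin L ⊕ Fin M) :=
  Equiv.ofBijective
    (fun a => finSumFinEquiv.symm ⟨shuffleVal L M l.1 a, shuffleVal_lt l.2 a⟩)
    (Finite.injective_iff_bijective.1 fun a b h => shuffleVal_injective l.2 (by simpa using h))

theorem finSumFinEquiv_shuffle (l : boundedPartitions L M) (a : Fin L ⊕ Fin M) :
    (finSumFinEquiv (shuffle l a) : ℕ) = shuffleVal L M l.1 a := by
  simp [shuffle]

theorem rowLen_eq_of_colLen_le {l : YoungDiagram} {L i : ℕ} (hl : l.colLen 0 ≤ L) (hi : L ≤ i) :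
    l.rowLen i = 0 := by
  have := (rowLen_le_iff_colLen_le (l := l) (j := i) (k := 0)).2 (hl.trans hi)
  omega

theorem ext_rowLen {l l' : YoungDiagram} (h : ∀ i, l.rowLen i = l'.rowLen i) : l = l' := by
  ext ⟨i, j⟩
  rw [YoungDiagram.mem_cells, YoungDiagram.mem_cells, YoungDiagram.mem_iff_lt_rowLen,
    YoungDiagram.mem_iff_lt_rowLen, h]

theorem shuffleVal_inl_strictAnti (l : YoungDiagram) :
    StrictAnti fun j : Fin L => shuffleVal L M l (.inl j) := by
  intro i j hij
  have := l.rowLen_anti i j hij.le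
  simp only [shuffleVal, Sum.elim_inl, stair]
  omega

/-- The exponents on the first block determine the partition. -/
theorem shuffle_coset_injective (l l' : boundedPartitions L M)
    (h : ((shuffle l)⁻¹ * shuffle l') ∈ (Equiv.Perm.sumCongrHom (Fin L) (Fin M)).range) :
    l = l' := by
  obtain ⟨⟨α, β⟩, h⟩ := h
  rw [eq_inv_mul_iff_mul_eq] at h
  have hv : ∀ j, shuffleVal L M l'.1 (.inl j) = shuffleVal L M l.1 (.inl (α j)) := fun j => by
    rw [← finSumFinEquiv_shuffle, ← finSumFinEquiv_shuffle, ← h]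
    simp
  have hr : (fun j : Fin L => shuffleVal L M l'.1 (.inl j)) =
      fun j : Fin L => shuffleVal L M l.1 (.inl j) := by
    rw [← StrictAnti.range_inj (shuffleVal_inl_strictAnti _) (shuffleVal_inl_strictAnti _)]
    ext v
    constructor
    · rintro ⟨j, rfl⟩
      exact ⟨α j, (hv j).symm⟩
    · rintro ⟨j, rfl⟩
      exact ⟨α.symm j, by simp [hv]⟩
  refine Subtype.ext (ext_rowLen fun i => ?_)
  by_cases hi : i < L
  · have := congrFun hr ⟨i, hi⟩
    simpa [shuffleVal] using this.symm
  · rw [rowLen_eq_of_colLen_le (mem_boundedPartitions.1 l.2).1 (not_lt.1 hi),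
      rowLen_eq_of_colLen_le (mem_boundedPartitions.1 l'.2).1 (not_lt.1 hi)]

/-- Every decreasing sequence in `{0, …, L + M - 1}` is `l_j + L - 1 - j` for a partition `l` in the
rectangle. -/
theorem exists_boundedPartition_of_strictAnti (s : Fin L → ℕ) (hs : StrictAnti s)
    (hlt : ∀ j, s j < L + M) :
    ∃ l ∈ boundedPartitions L M, ∀ j : Fin L, shuffleVal L M l (.inl j) = s j := by
  have hanti : ∀ i j : Fin L, i ≤ j → s j + (j - i : ℕ) ≤ s i := by
    intro i j hij
    obtain ⟨i, hi⟩ := i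
    obtain ⟨j, hj⟩ := j
    simp only [Fin.mk_le_mk] at hij
    induction j, hij using Nat.le_induction with
    | base => simp
    | succ k hk ih =>
      have h1 := ih (by omega)
      have h2 : s ⟨k + 1, hj⟩ < s ⟨k, by omega⟩ := hs (by simp)
      simp only at h1 h2 ⊢
      omega
  have hge : ∀ j : Fin L, stair L j ≤ s j := by
    intro j
    have h := hanti j ⟨L - 1, Nat.sub_one_lt_of_lt j.isLt⟩ (Fin.le_def.2 (Nat.le_sub_one_of_lt j.isLt))
    simp only [stair] at h ⊢
    omega
  have hle : ∀ j : Fin L, s j ≤ M + stair L j := by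
    intro j
    have h := hanti ⟨0, j.pos⟩ j (by simp [Fin.le_def])
    have := hlt ⟨0, j.pos⟩
    simp only [stair] at h ⊢
    omega
  let l : YoungDiagram := YoungDiagram.ofRowLens (List.ofFn fun j : Fin L => s j - stair L j) (by
    rw [List.sortedGE_ofFn_iff]
    intro i j hij
    have := hanti i j hij
    have := hge i
    have := hge j
    simp only [stair] at *
    omega)
  have hmem : ∀ i j, (i, j) ∈ l ↔ ∃ h : i < L, j < s ⟨i, h⟩ - stair L ⟨i, h⟩ := by
    intro i j
    simp [l, YoungDiagram.mem_ofRowLens]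
  have hrow : ∀ j : Fin L, l.rowLen j = s j - stair L j := by
    intro j
    refine eq_of_forall_lt_iff fun c => ?_
    rw [← YoungDiagram.mem_iff_lt_rowLen, hmem]
    simp
  refine ⟨l, mem_boundedPartitions.2 ⟨?_, ?_⟩, fun j => ?_⟩
  · by_contra! h
    rw [← YoungDiagram.mem_iff_lt_colLen, hmem] at h
    exact absurd h.1 (lt_irrefl _)
  · by_contra! h
    rw [← YoungDiagram.mem_iff_lt_rowLen, hmem] at h
    obtain ⟨h0, h⟩ := h
    have := hle ⟨0, h0⟩
    omega
  · simp only [shuffleVal, Sum.elim_inl, hrow]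
    have := hge j
    omega

/-- The shuffles represent all cosets: sorting the image of the first block gives the partition. -/
theorem shuffle_coset_surjective (σ : Equiv.Perm (Fin L ⊕ Fin M)) :
    ∃ l : boundedPartitions L M,
      ((shuffle l)⁻¹ * σ) ∈ (Equiv.Perm.sumCongrHom (Fin L) (Fin M)).range := by
  let S : Finset (Fin (L + M)) := Finset.univ.image fun j : Fin L => finSumFinEquiv (σ (.inl j))
  have hS : S.card = L := by
    rw [Finset.card_image_of_injective]
    · simp
    · intro a b h
      simpa using h
  obtain ⟨l, hl, hs⟩ := exists_boundedPartition_of_strictAnti (L := L) (M := M)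
    (fun j => (S.orderEmbOfFin hS j.rev : ℕ))
    (fun i j hij => by simpa using hij) (fun j => by simp)
  refine ⟨⟨l, hl⟩, Equiv.Perm.mem_sumCongrHom_range_of_perm_mapsTo_inl ?_⟩
  rintro _ ⟨j, rfl⟩
  have hj : finSumFinEquiv (σ (.inl j)) ∈ Set.range (S.orderEmbOfFin hS) := by
    rw [Finset.range_orderEmbOfFin]
    simp [S]
  obtain ⟨i, hi⟩ := hj
  refine ⟨i.rev, ?_⟩
  rw [Equiv.Perm.mul_apply, Equiv.Perm.eq_inv_iff_eq, ← finSumFinEquiv.apply_eq_iff_eq, Fin.ext_iff,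
    finSumFinEquiv_shuffle, hs, ← hi]
  simp

end Shuffle

/-! ### The sign of the shuffle -/

section Sign

variable {L M : ℕ}

/-- A partition in the rectangle with at least one box has a corner; removing it lowers one row
and one column by a box. -/
theorem exists_remove_corner {l : YoungDiagram} (hl : l ∈ boundedPartitions L M)
    (h0 : l.rowLen 0 ≠ 0) :
    ∃ l' ∈ boundedPartitions L M, ∃ (r : Fin L) (c : Fin M),
      l.rowLen r = c + 1 ∧ l.colLen c = r + 1 ∧ l'.rowLen r = c ∧ l'.colLen c = r ∧
      (∀ i, i ≠ (r : ℕ) → l'.rowLen i = l.rowLen i) ∧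
      (∀ k, k ≠ (c : ℕ) → l'.colLen k = l.colLen k) := by
  obtain ⟨h1, h2⟩ := mem_boundedPartitions.1 hl
  have hc0 : 0 < l.colLen 0 := by
    rw [← YoungDiagram.mem_iff_lt_colLen, YoungDiagram.mem_iff_lt_rowLen]
    omega
  obtain ⟨r, hr⟩ : ∃ r, l.colLen 0 = r + 1 := ⟨l.colLen 0 - 1, by omega⟩
  have hr0 : 0 < l.rowLen r := by
    rw [← YoungDiagram.mem_iff_lt_rowLen, YoungDiagram.mem_iff_lt_colLen]
    omega
  obtain ⟨c, hc⟩ : ∃ c, l.rowLen r = c + 1 := ⟨l.rowLen r - 1, by omega⟩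
  have hcM : c < M := by
    have := l.rowLen_anti 0 r (Nat.zero_le _)
    omega
  have hmax : ∀ i k, (i, k) ∈ l → r ≤ i → c ≤ k → i = r ∧ k = c := by
    intro i k hik hri hck
    have h3 : i < l.colLen k := YoungDiagram.mem_iff_lt_colLen.1 hik
    have h4 := l.colLen_anti 0 k (Nat.zero_le _)
    have hir : i = r := by omega
    subst hir
    have h5 : k < l.rowLen i := YoungDiagram.mem_iff_lt_rowLen.1 hik
    omega
  -- The corner is the last box of the last row.
  let l' : YoungDiagram :=
    { cells := l.cells.erase (r, c)
      isLowerSet := by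
        rintro ⟨i, k⟩ ⟨i', k'⟩ hle hmem
        simp only [Finset.coe_erase, Set.mem_sdiff, Finset.mem_coe, YoungDiagram.mem_cells,
          Set.mem_singleton_iff, Prod.mk.injEq] at hmem ⊢
        refine ⟨l.up_left_mem hle.1 hle.2 hmem.1, ?_⟩
        rintro ⟨rfl, rfl⟩
        exact hmem.2 (hmax i k hmem.1 hle.1 hle.2) }
  have hmem : ∀ i k, (i, k) ∈ l' ↔ (i, k) ∈ l ∧ ¬ (i = r ∧ k = c) := by
    intro i k
    rw [← YoungDiagram.mem_cells]
    simp only [l', Finset.mem_erase, YoungDiagram.mem_cells, ne_eq, Prod.mk.injEq]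
    tauto
  have hrow : ∀ i k, k < l'.rowLen i ↔ k < l.rowLen i ∧ ¬ (i = r ∧ k = c) := fun i k => by
    rw [← YoungDiagram.mem_iff_lt_rowLen, ← YoungDiagram.mem_iff_lt_rowLen, hmem]
  have hcol : ∀ i k, i < l'.colLen k ↔ i < l.colLen k ∧ ¬ (i = r ∧ k = c) := fun i k => by
    rw [← YoungDiagram.mem_iff_lt_colLen, ← YoungDiagram.mem_iff_lt_colLen, hmem]
  have hcolc : l.colLen c = r + 1 := by
    have h3 := l.colLen_anti 0 c (Nat.zero_le _)
    have h4 : r < l.colLen c := by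
      rw [← YoungDiagram.mem_iff_lt_colLen, YoungDiagram.mem_iff_lt_rowLen]
      omega
    omega
  have hrowne : ∀ i, i ≠ r → l'.rowLen i = l.rowLen i := fun i hi =>
    eq_of_forall_lt_iff fun k => by simp [hrow, hi]
  have hcolne : ∀ k, k ≠ c → l'.colLen k = l.colLen k := fun k hk =>
    eq_of_forall_lt_iff fun i => by simp [hcol, hk]
  have hrowr : l'.rowLen r = c := eq_of_forall_lt_iff fun k => by rw [hrow, hc]; omega
  have hcolc' : l'.colLen c = r := eq_of_forall_lt_iff fun i => by rw [hcol, hcolc]; omega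
  refine ⟨l', mem_boundedPartitions.2 ⟨?_, ?_⟩, ⟨r, by omega⟩, ⟨c, hcM⟩, hc, hcolc, hrowr, hcolc',
    hrowne, hcolne⟩
  · by_cases h : 0 = c
    · have := hcolc'
      rw [← h] at this
      omega
    · rw [hcolne 0 h]
      exact h1
  · by_cases h : 0 = r
    · have := hrowr
      rw [← h] at this
      omega
    · rw [hrowne 0 h]
      exact h2

/-- The sign alternates with the number of boxes, since adding a box to `l` multiplies its shuffle by
a transposition; the empty partition gives the reversal of the first block. -/
theorem sign_shuffle (l : boundedPartitions L M) :
    Equiv.Perm.sign (shuffle l) =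
      (-1) ^ (∑ k : Fin M, l.1.colLen k) *
        Equiv.Perm.sign (Fin.revPerm : Equiv.Perm (Fin L)) := by
  obtain ⟨l, hl⟩ := l
  induction hs : ∑ k : Fin M, l.colLen k generalizing l with
  | zero =>
    simp only [Finset.sum_eq_zero_iff, Finset.mem_univ, true_imp_iff] at hs
    have hrow : ∀ i, l.rowLen i = 0 := by
      intro i
      have h1 := l.rowLen_anti 0 i (Nat.zero_le _)
      have h2 := (mem_boundedPartitions.1 hl).2
      rcases Nat.eq_zero_or_pos M with hM | hM
      · omega
      · have := rowLen_le_iff_colLen_le (l := l) (j := i) (k := 0)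
        have := hs ⟨0, hM⟩
        simp only at this
        omega
    have : shuffle ⟨l, hl⟩ = Equiv.Perm.sumCongr Fin.revPerm 1 := by
      ext1 a
      rw [← finSumFinEquiv.apply_eq_iff_eq, Fin.ext_iff, finSumFinEquiv_shuffle]
      rcases a with j | k
      · simp [shuffleVal, hrow, stair, Fin.val_rev]
        omega
      · simp [shuffleVal, hs]
    rw [this, Equiv.Perm.sign_sumCongr]
    simp
  | succ s ih =>
    have h0 : l.rowLen 0 ≠ 0 := by
      intro h0
      have : ∀ k, l.colLen k = 0 := fun k => by
        have := rowLen_le_iff_colLen_le (l := l) (j := 0) (k := k)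
        omega
      simp [this] at hs
    obtain ⟨l', hl', r, c, hr, hc, hr', hc', hrow, hcol⟩ := exists_remove_corner hl h0
    have hs' : ∑ k : Fin M, l'.colLen k = s := by
      have h1 : ∀ k : Fin M, l.colLen k = l'.colLen k + if k = c then 1 else 0 := by
        intro k
        split_ifs with h
        · rw [h, hc, hc']
        · rw [hcol k (fun h' => h (Fin.ext h')), add_zero]
      simp only [h1, Finset.sum_add_distrib, Finset.sum_ite_eq', Finset.mem_univ, if_true] at hs
      omega
    have hmul : shuffle ⟨l, hl⟩ = shuffle ⟨l', hl'⟩ * Equiv.swap (.inl r) (.inr c) := by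
      ext1 a
      rw [← finSumFinEquiv.apply_eq_iff_eq, Fin.ext_iff, finSumFinEquiv_shuffle,
        Equiv.Perm.mul_apply, finSumFinEquiv_shuffle]
      rcases a with j | k
      · by_cases hj : j = r
        · subst hj
          rw [Equiv.swap_apply_left]
          simp only [shuffleVal, Sum.elim_inl, Sum.elim_inr, stair, hr, hc']
          omega
        · rw [Equiv.swap_apply_of_ne_of_ne (by simpa using hj) (by simp)]
          simp only [shuffleVal, Sum.elim_inl, hrow j (fun h => hj (Fin.ext h))]
      · by_cases hk : k = c
        · subst hk
          rw [Equiv.swap_apply_right]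
          simp only [shuffleVal, Sum.elim_inl, Sum.elim_inr, stair, hc, hr']
          omega
        · rw [Equiv.swap_apply_of_ne_of_ne (by simp) (by simpa using hk)]
          simp only [shuffleVal, Sum.elim_inr, hcol k (fun h => hk (Fin.ext h))]
    rw [hmul, Equiv.Perm.sign_mul, ih l' hl' hs', Equiv.Perm.sign_swap (by simp), pow_succ]
    simp only [mul_assoc, mul_comm]

end Sign

/-! ### The dual Cauchy identity -/

/-- Homogeneity of the Schur polynomial, with a factor `vdm z` so that no cancellation is needed. -/
theorem vdm_mul_schur_neg {R : Type*} [CommRing R] {m : ℕ} (l : YoungDiagram)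
    (hl : l.colLen 0 ≤ m) (z : Fin m → R) :
    vdm z * schur l (fun i => -z i) =
      (-1) ^ (∑ j : Fin m, l.rowLen j) * (vdm z * schur l z) := by
  have key : ∀ e : Fin m → ℕ, (Matrix.of fun i j : Fin m => (-z i) ^ e j).det =
      (-1) ^ (∑ j, e j) * (Matrix.of fun i j : Fin m => z i ^ e j).det := by
    intro e
    rw [← Finset.prod_pow_eq_pow_sum, ← Matrix.det_mul_row]
    congr 1
    ext i j
    simp [neg_pow (z i)]
  rw [← det_neg_pow_stair, det_pow_stair_mul_schur l hl (fun i => -z i), key, key,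
    Finset.sum_add_distrib, pow_add, ← det_pow_stair_mul_schur l hl z]
  ring

/-- The dual Cauchy identity multiplied by both Vandermonde products. -/
theorem vdm_mul_prod_mul_vdm {R : Type*} [CommRing R] {L M : ℕ} (t : Fin L → R) (z : Fin M → R) :
    vdm t * (∏ i, ∏ k, (1 + t i * z k)) * vdm z =
      ∑ l ∈ boundedPartitions L M, (vdm t * schur l t) * (vdm z * schur l.transpose z) := by
  let v : Fin (L + M) → R := Fin.append t 1
  let w : Fin (L + M) → R := Fin.append 1 (fun k => -z k)
  have h1 : vdm t * (∏ i, ∏ k, (1 + t i * z k)) * vdm z = (Matrix.projVandermonde v w).det := by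
    rw [Matrix.det_projVandermonde, prod_Ioi_add]
    simp [v, w, vdm, neg_add_eq_sub]
  rw [h1, ← Matrix.det_submatrix_equiv_self finSumFinEquiv,
    det_eq_sum_det_mul_det shuffle shuffle_coset_injective shuffle_coset_surjective,
    ← Finset.sum_coe_sort (boundedPartitions L M)
      fun l => (vdm t * schur l t) * (vdm z * schur l.transpose z)]
  refine Finset.sum_congr rfl fun l _ => ?_
  obtain ⟨hl1, hl2⟩ := mem_boundedPartitions.1 l.2
  have hA : (Matrix.of fun a b : Fin L => (Matrix.projVandermonde v w).submatrix finSumFinEquiv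
      finSumFinEquiv (.inl a) (shuffle l (.inl b))).det =
      (Equiv.Perm.sign (Fin.revPerm : Equiv.Perm (Fin L)) : R) * (vdm t * schur l.1 t) := by
    rw [← mul_assoc, ← det_pow_stair, det_pow_stair_mul_schur l.1 hl1]
    congr 1
    ext a b
    simp [Matrix.projVandermonde_apply, finSumFinEquiv_shuffle, shuffleVal, v, w]
  have hB : (Matrix.of fun a b : Fin M => (Matrix.projVandermonde v w).submatrix finSumFinEquiv
      finSumFinEquiv (.inr a) (shuffle l (.inr b))).det =
      (-1) ^ (∑ k : Fin M, l.1.colLen k) * (vdm z * schur l.1.transpose z) := by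
    have hl2' : l.1.transpose.colLen 0 ≤ M := by simpa using hl2
    have h := vdm_mul_schur_neg l.1.transpose hl2' z
    simp only [YoungDiagram.rowLen_transpose] at h
    rw [← h, ← det_neg_pow_stair, det_pow_stair_mul_schur _ hl2' (fun i => -z i)]
    congr 1
    ext a b
    have := l.1.colLen_anti 0 b (Nat.zero_le _)
    simp only [Matrix.submatrix_apply, Matrix.of_apply, Matrix.projVandermonde_apply, Fin.val_rev,
      finSumFinEquiv_shuffle, shuffleVal, v, w, finSumFinEquiv_apply_right, Fin.append_right,
      Sum.elim_inr, Pi.one_apply, one_pow, one_mul, YoungDiagram.rowLen_transpose, stair]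
    congr 1
    omega
  rw [hA, hB, sign_shuffle]
  push_cast
  have e1 : (((Equiv.Perm.sign (Fin.revPerm : Equiv.Perm (Fin L)) : ℤ) : R)) *
      ((Equiv.Perm.sign (Fin.revPerm : Equiv.Perm (Fin L)) : ℤ) : R) = 1 := by
    rw [← Int.cast_mul, ← Units.val_mul, Int.units_mul_self]
    simp
  have e2 : ((-1 : R) ^ (∑ k : Fin M, l.1.colLen k)) *
      (-1 : R) ^ (∑ k : Fin M, l.1.colLen k) = 1 := by
    rw [← mul_pow]
    simp
  linear_combination (vdm t * schur l.1 t * (vdm z * schur l.1.transpose z)) *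
    (((-1 : R) ^ (∑ k : Fin M, l.1.colLen k)) * (-1 : R) ^ (∑ k : Fin M, l.1.colLen k) * e1 + e2)

theorem vdm_ne_zero {R : Type*} [CommRing R] [IsDomain R] {m : ℕ} {z : Fin m → R}
    (hz : Function.Injective z) : vdm z ≠ 0 := by
  rw [vdm_eq_det]
  exact Matrix.det_vandermonde_ne_zero_iff.2 hz

/-- The dual Cauchy identity, over any commutative ring. -/
theorem prod_one_add_mul_eq_sum_schur {R : Type*} [CommRing R] {L M : ℕ} (t : Fin L → R)
    (z : Fin M → R) :
    ∏ i, ∏ k, (1 + t i * z k) =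
      ∑ l ∈ boundedPartitions L M, schur l t * schur l.transpose z := by
  -- For independent variables the Vandermonde factors can be cancelled; then specialise.
  let T : Fin L → MvPolynomial (Fin L ⊕ Fin M) ℤ := fun i => MvPolynomial.X (.inl i)
  let Z : Fin M → MvPolynomial (Fin L ⊕ Fin M) ℤ := fun k => MvPolynomial.X (.inr k)
  have hT : vdm T ≠ 0 := vdm_ne_zero fun i j h => by
    simpa using MvPolynomial.X_injective h
  have hZ : vdm Z ≠ 0 := vdm_ne_zero fun i j h => by
    simpa using MvPolynomial.X_injective h
  have key : ∏ i, ∏ k, (1 + T i * Z k) =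
      ∑ l ∈ boundedPartitions L M, schur l T * schur l.transpose Z := by
    refine mul_left_cancel₀ (mul_ne_zero hT hZ) ?_
    have h := vdm_mul_prod_mul_vdm T Z
    rw [mul_right_comm] at h
    rw [h, Finset.mul_sum]
    exact Finset.sum_congr rfl fun l _ => by ring
  have := congrArg (MvPolynomial.aeval (R := ℤ) (Sum.elim t z)).toRingHom key
  simp only [map_prod, map_sum, map_mul, map_add, map_one, map_schur] at this
  simpa [T, Z] using this

/-! ### Integrals of products of two determinants -/

/-- Each injective map `n → m ⊕ n` is the restriction of `(card m)!` permutations of `m ⊕ n`. -/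
theorem sum_perm_comp_inr {m n R : Type*} [Fintype m] [Fintype n] [DecidableEq m] [DecidableEq n]
    [CommRing R] (F : (n → m ⊕ n) → R) (hF : ∀ s, ¬ Function.Injective s → F s = 0) :
    ∑ σ : Equiv.Perm (m ⊕ n), F (fun i => σ (.inr i)) =
      ((Fintype.card m).factorial : R) * ∑ s, F s := by
  classical
  have hcard : ∀ f : n ↪ m ⊕ n, Fintype.card (m ↪ ↥(Set.range f)ᶜ) = (Fintype.card m).factorial := by
    intro f
    have : Fintype.card ↥(Set.range f)ᶜ = Fintype.card m := by
      rw [Fintype.card_compl_set, Set.card_range_of_injective f.injective]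
      simp
    rw [Fintype.card_embedding_eq, this, Nat.descFactorial_self]
  let e : Equiv.Perm (m ⊕ n) ≃ Σ f : n ↪ m ⊕ n, m ↪ ↥(Set.range f)ᶜ :=
    (Equiv.embeddingEquivOfFinite (m ⊕ n)).symm.trans
      ((Equiv.embeddingCongr (Equiv.sumComm m n) (Equiv.refl _)).trans
        Equiv.sumEmbeddingEquivSigmaEmbeddingRestricted)
  calc ∑ σ : Equiv.Perm (m ⊕ n), F (fun i => σ (.inr i))
      = ∑ p : Σ f : n ↪ m ⊕ n, m ↪ ↥(Set.range f)ᶜ, F p.1 :=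
        Fintype.sum_equiv e _ _ fun σ => rfl
    _ = ∑ f : n ↪ m ⊕ n, ((Fintype.card m).factorial : R) * F f := by
        rw [Fintype.sum_sigma]
        refine Finset.sum_congr rfl fun f _ => ?_
        simp only [Finset.sum_const, Finset.card_univ, hcard, nsmul_eq_mul]
    _ = ((Fintype.card m).factorial : R) * ∑ s, F s := by
        rw [← Finset.mul_sum]
        congr 1
        refine Finset.sum_of_injOn (fun f => f) (fun a _ b _ h => DFunLike.coe_injective h)
          (by simp) (fun s _ hs => hF s fun hinj => hs ?_) (fun _ _ => rfl)
        exact ⟨⟨s, hinj⟩, by simp, rfl⟩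

section Andreief

variable {m n : Type*} [Fintype m] [Fintype n] [DecidableEq m] [DecidableEq n]

/-- The square matrix with rows `(f_c(z_k))_c` for `k : m`, followed by the constant rows
`(X_{i, c})_c` for `i : n`. -/
def bordered (f : m ⊕ n → ℝ → ℂ) (X : n → m ⊕ n → ℂ) (z : m → ℝ) : Matrix (m ⊕ n) (m ⊕ n) ℂ :=
  Matrix.of fun a c => Sum.elim (fun k => f c (z k)) (fun i => X i c) a

theorem det_bordered (f : m ⊕ n → ℝ → ℂ) (X : n → m ⊕ n → ℂ) (z : m → ℝ) :
    (bordered f X z).det = ∑ σ : Equiv.Perm (m ⊕ n), ((Equiv.Perm.sign σ : ℤ) : ℂ) *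
      ((∏ k, f (σ (.inl k)) (z k)) * ∏ i, X i (σ (.inr i))) := by
  rw [← Matrix.det_transpose, Matrix.det_apply']
  simp [bordered, Fintype.prod_sum_type]

theorem integral_det_bordered_mul_det_bordered (w : ℝ → ℂ) (f g : m ⊕ n → ℝ → ℂ)
    (X Y : n → m ⊕ n → ℂ) (hint : ∀ c c', Integrable fun u => f c u * g c' u * w u) :
    ∫ z : m → ℝ, (bordered f X z).det * (bordered g Y z).det * ∏ k, w (z k) =
      ∑ σ : Equiv.Perm (m ⊕ n), ∑ τ : Equiv.Perm (m ⊕ n),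
        (((Equiv.Perm.sign σ : ℤ) : ℂ) * ∏ i, X i (σ (.inr i))) *
        (((Equiv.Perm.sign τ : ℤ) : ℂ) * ((∏ k, ∫ u, f (σ (.inl k)) u * g (τ (.inl k)) u * w u) *
          ∏ i, Y i (τ (.inr i)))) := by
  have hexp : ∀ z : m → ℝ, (bordered f X z).det * (bordered g Y z).det * ∏ k, w (z k) =
      ∑ σ : Equiv.Perm (m ⊕ n), ∑ τ : Equiv.Perm (m ⊕ n),
        ((((Equiv.Perm.sign σ : ℤ) : ℂ) * ∏ i, X i (σ (.inr i))) *
        (((Equiv.Perm.sign τ : ℤ) : ℂ) * ∏ i, Y i (τ (.inr i)))) *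
          ∏ k, (f (σ (.inl k)) (z k) * g (τ (.inl k)) (z k) * w (z k)) := by
    intro z
    rw [det_bordered, det_bordered, Finset.sum_mul_sum, Finset.sum_mul]
    refine Finset.sum_congr rfl fun σ _ => ?_
    rw [Finset.sum_mul]
    refine Finset.sum_congr rfl fun τ _ => ?_
    rw [Finset.prod_mul_distrib, Finset.prod_mul_distrib]
    ring
  have hi : ∀ σ τ : Equiv.Perm (m ⊕ n), Integrable fun z : m → ℝ =>
      ((((Equiv.Perm.sign σ : ℤ) : ℂ) * ∏ i, X i (σ (.inr i))) *
        (((Equiv.Perm.sign τ : ℤ) : ℂ) * ∏ i, Y i (τ (.inr i)))) *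
          ∏ k, (f (σ (.inl k)) (z k) * g (τ (.inl k)) (z k) * w (z k)) := fun σ τ =>
    (Integrable.fintype_prod_dep
      (f := fun k u => f (σ (.inl k)) u * g (τ (.inl k)) u * w u) fun k => hint _ _).const_mul _
  simp only [hexp]
  rw [integral_finsetSum _ fun σ _ => integrable_finsetSum _ fun τ _ => hi σ τ]
  refine Finset.sum_congr rfl fun σ _ => ?_
  rw [integral_finsetSum _ fun τ _ => hi σ τ]
  refine Finset.sum_congr rfl fun τ _ => ?_
  rw [integral_const_mul, integral_fintype_prod_volume_eq_prod
    (fun k u => f (σ (.inl k)) u * g (τ (.inl k)) u * w u)]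
  ring

/-- Andréief's identity for an orthogonal family, with extra constant rows. -/
theorem integral_det_bordered_of_orthogonal (w : ℝ → ℂ) (f : m ⊕ n → ℝ → ℂ) (h : m ⊕ n → ℂ)
    (X Y : n → m ⊕ n → ℂ) (hint : ∀ c c', Integrable fun u => f c u * f c' u * w u)
    (horth : ∀ c c', ∫ u, f c u * f c' u * w u = if c = c' then h c else 0) (hh : ∀ c, h c ≠ 0) :
    ∫ z : m → ℝ, (bordered f X z).det * (bordered f Y z).det * ∏ k, w (z k) =
      ((Fintype.card m).factorial : ℂ) * (∏ c, h c) *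
        (Matrix.of fun i j : n => ∑ c, X i c * Y j c / h c).det := by
  rw [integral_det_bordered_mul_det_bordered w f f X Y hint]
  simp only [horth]
  let F : (n → m ⊕ n) → ℂ := fun s =>
    (∏ i, X i (s i) / h (s i)) * (Matrix.of fun i j => Y i (s j)).det
  have hF : ∀ s, ¬ Function.Injective s → F s = 0 := by
    intro s hs
    simp only [Function.Injective, not_forall] at hs
    obtain ⟨i, j, hij, hne⟩ := hs
    simp only [F]
    rw [Matrix.det_zero_of_column_eq hne, mul_zero]
    intro k
    simp [hij]
  -- For fixed `σ` the sum over `τ` is a determinant that is block triangular after permuting its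
  -- columns by `σ`.
  have hinner : ∀ σ : Equiv.Perm (m ⊕ n), ∑ τ : Equiv.Perm (m ⊕ n),
        (((Equiv.Perm.sign σ : ℤ) : ℂ) * ∏ i, X i (σ (.inr i))) *
        (((Equiv.Perm.sign τ : ℤ) : ℂ) *
          ((∏ k, if σ (.inl k) = τ (.inl k) then h (σ (.inl k)) else 0) *
          ∏ i, Y i (τ (.inr i)))) = (∏ c, h c) * F (fun i => σ (.inr i)) := by
    intro σ
    let B : Matrix (m ⊕ n) (m ⊕ n) ℂ := Matrix.of fun a c =>
      Sum.elim (fun k => if σ (.inl k) = c then h (σ (.inl k)) else 0) (fun i => Y i c) a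
    have hB : B.det = ∑ τ : Equiv.Perm (m ⊕ n), ((Equiv.Perm.sign τ : ℤ) : ℂ) *
          ((∏ k, if σ (.inl k) = τ (.inl k) then h (σ (.inl k)) else 0) *
          ∏ i, Y i (τ (.inr i))) := by
      rw [← Matrix.det_transpose, Matrix.det_apply']
      simp [B, Fintype.prod_sum_type]
    have hB' : ((Equiv.Perm.sign σ : ℤ) : ℂ) * B.det =
        (∏ k, h (σ (.inl k))) * (Matrix.of fun i j => Y i (σ (.inr j))).det := by
      rw [← Matrix.det_permute', ← Matrix.det_diagonal, ← Matrix.det_fromBlocks_zero₁₂ _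
        (Matrix.of fun i k => Y i (σ (.inl k)))]
      congr 1
      ext (a | a) (b | b) <;> simp [B, Matrix.diagonal_apply]
    rw [← Finset.mul_sum, ← hB, mul_right_comm, hB', ← Equiv.prod_comp σ, Fintype.prod_sum_type]
    simp only [F, Finset.prod_div_distrib]
    have : ∏ i, h (σ (.inr i)) ≠ 0 := Finset.prod_ne_zero_iff.2 fun i _ => hh _
    field_simp
  rw [Finset.sum_congr rfl fun σ _ => hinner σ, ← Finset.mul_sum, sum_perm_comp_inr F hF]
  have hdet : (Matrix.of fun i j : n => ∑ c, X i c * Y j c / h c).det = ∑ s, F s := by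
    rw [← Matrix.det_transpose, Matrix.det_apply']
    simp only [F, Matrix.transpose_apply, Matrix.of_apply, Finset.prod_univ_sum,
      Fintype.piFinset_univ, Finset.mul_sum, Matrix.det_apply']
    rw [Finset.sum_comm]
    refine Finset.sum_congr rfl fun s _ => Finset.sum_congr rfl fun σ _ => ?_
    rw [mul_left_comm, ← Finset.prod_mul_distrib]
    congr 1
    exact Finset.prod_congr rfl fun i _ => by ring
  rw [hdet]
  ring

theorem integrable_det_mul_det (w : ℝ → ℂ) (f g : m → ℝ → ℂ)
    (hint : ∀ c c', Integrable fun u => f c u * g c' u * w u) :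
    Integrable fun z : m → ℝ => (Matrix.of fun i j => f j (z i)).det *
      (Matrix.of fun i j => g j (z i)).det * ∏ k, w (z k) := by
  have hexp : ∀ z : m → ℝ, (Matrix.of fun i j => f j (z i)).det *
      (Matrix.of fun i j => g j (z i)).det * ∏ k, w (z k) =
      ∑ σ : Equiv.Perm m, ∑ τ : Equiv.Perm m,
        (((Equiv.Perm.sign σ : ℤ) : ℂ) * ((Equiv.Perm.sign τ : ℤ) : ℂ)) *
          ∏ k, (f (σ k) (z k) * g (τ k) (z k) * w (z k)) := by
    intro z
    rw [← Matrix.det_transpose, Matrix.det_apply', ← Matrix.det_transpose, Matrix.det_apply',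
      Finset.sum_mul_sum, Finset.sum_mul]
    refine Finset.sum_congr rfl fun σ _ => ?_
    rw [Finset.sum_mul]
    refine Finset.sum_congr rfl fun τ _ => ?_
    simp only [Matrix.transpose_apply, Matrix.of_apply, Finset.prod_mul_distrib]
    ring
  simp only [hexp]
  exact integrable_finsetSum _ fun σ _ => integrable_finsetSum _ fun τ _ =>
    (Integrable.fintype_prod_dep
      (f := fun k u => f (σ k) u * g (τ k) u * w u) fun k => hint _ _).const_mul _

end Andreief

/-! ### The kernel as an average of characteristic polynomials -/

section Kernel

variable {M n : ℕ}

/-- Both sides are the Vandermonde determinant of the variables `z` followed by `x`. -/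
theorem vdm_append_eq_det_bordered (w : ℝ → ℝ) (z : Fin M → ℝ) (x : Fin n → ℂ) :
    vdm (fun k => (z k : ℂ)) * (∏ i, ∏ k, (x i - z k)) * vdm x =
      (bordered (fun c u => (((orthoPoly w (finSumFinEquiv c : Fin (M + n))).eval u : ℝ) : ℂ))
        (fun i c => Polynomial.aeval (x i) (orthoPoly w (finSumFinEquiv c : Fin (M + n)))) z).det := by
  rw [Finset.prod_comm, ← vdm_append, vdm_eq_det,
    Matrix.det_eval_matrixOfPolynomials_eq_det_vandermonde _
      (fun j : Fin (M + n) => (orthoPoly w j).map (algebraMap ℝ ℂ)),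
    ← Matrix.det_submatrix_equiv_self finSumFinEquiv]
  · congr 1
    ext (a | a) b
    · simp [bordered, Polynomial.eval_map_algebraMap, ← Complex.coe_algebraMap,
        Polynomial.aeval_algebraMap_apply]
    · simp [bordered, Polynomial.eval_map_algebraMap]
  · intro j
    rw [Polynomial.natDegree_map, (orthoPoly_monic_natDegree w j).2]
  · exact fun j => (orthoPoly_monic_natDegree w j).1.map _

theorem integrable_eval_mul_eval (w : ℝ → ℝ) (N : ℕ)
    (hw : ∀ k ≤ 2 * (N - 1), Integrable (fun z : ℝ => z ^ k * w z)) (p q : Polynomial ℝ)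
    (hpq : p.natDegree + q.natDegree ≤ 2 * (N - 1)) :
    Integrable fun u : ℝ => ((p.eval u : ℝ) : ℂ) * ((q.eval u : ℝ) : ℂ) * (w u : ℂ) := by
  have h := (integrable_eval_mul w _ hw (p * q) (Polynomial.natDegree_mul_le.trans hpq)).ofReal
    (𝕜 := ℂ)
  simpa using h

theorem innerW_comm (w : ℝ → ℝ) (p q : Polynomial ℝ) : innerW w p q = innerW w q p := by
  simp only [innerW, mul_comm (p.eval _)]

/-- The unnormalized average of a product of characteristic polynomials at `x` and at `y` is a
determinant of Christoffel-Darboux kernels. -/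
theorem vdm_mul_vdm_mul_integral (w : ℝ → ℝ) (hw_nonneg : ∀ z, 0 ≤ w z)
    (hw_ne : ¬ w =ᵐ[volume] 0)
    (hw_moments : ∀ k ≤ 2 * (M + n - 1), Integrable (fun z : ℝ => z ^ k * w z))
    (x y : Fin n → ℂ) :
    vdm x * vdm y * ∫ z : Fin M → ℝ, vdm (fun k => (z k : ℂ)) ^ 2 *
        ((∏ i, ∏ k, (x i - z k)) * ∏ i, ∏ k, (y i - z k)) * ∏ k, (w (z k) : ℂ) =
      (M.factorial : ℂ) * (∏ j ∈ Finset.range (M + n), (sqNorm w j : ℂ)) *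
        (Matrix.of fun i j : Fin n => cdKernel w (M + n) (x i) (y j)).det := by
  have horth := orthoPoly_orthogonal w (M + n) hw_nonneg hw_ne hw_moments
  have h := integral_det_bordered_of_orthogonal (m := Fin M) (n := Fin n) (fun u => (w u : ℂ))
    (fun c u => (((orthoPoly w (finSumFinEquiv c : Fin (M + n))).eval u : ℝ) : ℂ))
    (fun c => (sqNorm w (finSumFinEquiv c : Fin (M + n)) : ℂ))
    (fun i c => Polynomial.aeval (x i) (orthoPoly w (finSumFinEquiv c : Fin (M + n))))
    (fun i c => Polynomial.aeval (y i) (orthoPoly w (finSumFinEquiv c : Fin (M + n))))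
    (fun c c' => integrable_eval_mul_eval w (M + n) hw_moments _ _ (by
      rw [(orthoPoly_monic_natDegree w _).2, (orthoPoly_monic_natDegree w _).2]
      omega))
    (fun c c' => by
      have hr : ∫ u, (((orthoPoly w (finSumFinEquiv c : Fin (M + n))).eval u : ℝ) : ℂ) *
          (((orthoPoly w (finSumFinEquiv c' : Fin (M + n))).eval u : ℝ) : ℂ) * (w u : ℂ) =
          (innerW w (orthoPoly w (finSumFinEquiv c : Fin (M + n)))
            (orthoPoly w (finSumFinEquiv c' : Fin (M + n))) : ℝ) := by
        rw [innerW, ← integral_complex_ofReal]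
        push_cast
        rfl
      rw [hr]
      split_ifs with hc
      · rw [hc]
        rfl
      · have hne : ((finSumFinEquiv c : Fin (M + n)) : ℕ) ≠ (finSumFinEquiv c' : Fin (M + n)) :=
          fun h => hc (finSumFinEquiv.injective (Fin.ext h))
        rcases lt_or_gt_of_ne hne with hlt | hlt
        · rw [innerW_comm, (horth _ (Fin.isLt _)).2 _ hlt, Complex.ofReal_zero]
        · rw [(horth _ (Fin.isLt _)).2 _ hlt, Complex.ofReal_zero])
    (fun c => Complex.ofReal_ne_zero.2 (horth _ (Fin.isLt _)).1.ne')
  simp only [← vdm_append_eq_det_bordered, Fintype.card_fin] at h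
  rw [finSumFinEquiv.prod_comp (fun j : Fin (M + n) => (sqNorm w j : ℂ)),
    Fin.prod_univ_eq_prod_range (fun j => (sqNorm w j : ℂ))] at h
  have hK : ∀ a b : ℂ, ∑ c : Fin M ⊕ Fin n,
      Polynomial.aeval a (orthoPoly w (finSumFinEquiv c : Fin (M + n))) *
      Polynomial.aeval b (orthoPoly w (finSumFinEquiv c : Fin (M + n))) /
        (sqNorm w (finSumFinEquiv c : Fin (M + n)) : ℂ) = cdKernel w (M + n) a b := by
    intro a b
    rw [finSumFinEquiv.sum_comp (fun j : Fin (M + n) => Polynomial.aeval a (orthoPoly w j) *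
      Polynomial.aeval b (orthoPoly w j) / (sqNorm w j : ℂ)),
      Fin.sum_univ_eq_sum_range (fun j => Polynomial.aeval a (orthoPoly w j) *
      Polynomial.aeval b (orthoPoly w j) / (sqNorm w j : ℂ)), cdKernel]
  simp only [hK] at h
  rw [← h, ← integral_const_mul]
  refine integral_congr_ae (.of_forall fun z => ?_)
  ring

theorem vdm_ofReal {m : ℕ} (z : Fin m → ℝ) : vdm (fun k => (z k : ℂ)) = ((vdm z : ℝ) : ℂ) := by
  simp [vdm]

/-- The case `n = 0` of `vdm_mul_vdm_mul_integral`. -/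
theorem factorial_mul_partitionFn (w : ℝ → ℝ) (hw_nonneg : ∀ z, 0 ≤ w z)
    (hw_ne : ¬ w =ᵐ[volume] 0)
    (hw_moments : ∀ k ≤ 2 * (M - 1), Integrable (fun z : ℝ => z ^ k * w z)) :
    (M.factorial : ℝ) * partitionFn w M =
      M.factorial * ∏ j ∈ Finset.range M, sqNorm w j := by
  have h := vdm_mul_vdm_mul_integral (M := M) (n := 0) w hw_nonneg hw_ne (by simpa using hw_moments)
    Fin.elim0 Fin.elim0
  simp only [Finset.univ_eq_empty, Finset.prod_empty, mul_one, Matrix.det_isEmpty, add_zero,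
    vdm_ofReal, show ∀ a : Fin 0 → ℂ, vdm a = 1 from fun _ => rfl] at h
  have hM : (M.factorial : ℝ) ≠ 0 := by positivity
  rw [partitionFn, ← mul_assoc, mul_one_div_cancel hM, one_mul]
  simp only [one_mul] at h
  have h' : ((∫ z : Fin M → ℝ, vdm z ^ 2 * ∏ j, w (z j) : ℝ) : ℂ) =
      ((M.factorial * ∏ j ∈ Finset.range M, sqNorm w j : ℝ) : ℂ) := by
    rw [← integral_complex_ofReal]
    push_cast
    exact h
  exact_mod_cast h'

/-- The degree of `Δ(z)² s_l(z)` in each variable is at most `2 (M - 1) + 2 n`, because `Δ s_l` is an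
alternant. -/
theorem integrable_vdm_sq_mul_schur (w : ℝ → ℝ)
    (hw_moments : ∀ k ≤ 2 * (M + n - 1), Integrable (fun z : ℝ => z ^ k * w z))
    (l : YoungDiagram) (hl1 : l.colLen 0 ≤ M) (hl2 : l.rowLen 0 ≤ 2 * n) :
    Integrable fun z : Fin M → ℝ => vdm (fun k => (z k : ℂ)) ^ 2 *
      schur l (fun k => (z k : ℂ)) * ∏ k, (w (z k) : ℂ) := by
  have h := integrable_det_mul_det (m := Fin M) (fun u => (w u : ℂ))
    (fun j u => (u : ℂ) ^ stair M j) (fun j u => (u : ℂ) ^ (l.rowLen j + stair M j)) (fun c c' => by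
      have := integrable_eval_mul_eval w (M + n) hw_moments (Polynomial.X ^ stair M c)
        (Polynomial.X ^ (l.rowLen c' + stair M c')) (by
          have := l.rowLen_anti 0 c' (Nat.zero_le _)
          simp only [Polynomial.natDegree_X_pow, stair]
          omega)
      simpa using this)
  refine h.congr (.of_forall fun z => ?_)
  simp only
  rw [← det_pow_stair_mul_schur l hl1 (fun k => (z k : ℂ)), det_pow_stair]
  have e1 : (((Equiv.Perm.sign (Fin.revPerm : Equiv.Perm (Fin M)) : ℤ) : ℂ)) *
      ((Equiv.Perm.sign (Fin.revPerm : Equiv.Perm (Fin M)) : ℤ) : ℂ) = 1 := by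
    rw [← Int.cast_mul, ← Units.val_mul, Int.units_mul_self]
    simp
  linear_combination (vdm (fun k => (z k : ℂ)) ^ 2 *
      schur l (fun k => (z k : ℂ)) * ∏ k, (w (z k) : ℂ)) * e1

theorem prod_tVec (x y : Fin n → ℂ) (hx : ∀ i, x i ≠ 0) (hy : ∀ i, y i ≠ 0) (z : Fin M → ℂ) :
    ∏ i, ∏ k, (1 + tVec x y i * z k) =
      ((∏ i, ∏ k, (x i - z k)) * ∏ i, ∏ k, (y i - z k)) / ∏ i, (x i * y i) ^ M := by
  have h : ∀ a : Fin n → ℂ, (∀ i, a i ≠ 0) →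
      ∏ i, ∏ k, (1 + -1 / a i * z k) = (∏ i, ∏ k, (a i - z k)) / ∏ i, a i ^ M := by
    intro a ha
    rw [← Finset.prod_div_distrib]
    refine Finset.prod_congr rfl fun i _ => ?_
    rw [← Fin.prod_const, ← Finset.prod_div_distrib]
    refine Finset.prod_congr rfl fun k _ => ?_
    have := ha i
    field_simp
    ring
  simp only [Fin.prod_univ_add, tVec, Fin.append_left, Fin.append_right, h x hx, h y hy, mul_pow,
    Finset.prod_mul_distrib]
  rw [div_mul_div_comm]

/-- The Schur expansion at pairwise distinct points. -/
theorem hatKernel_eq_sum_schur (w : ℝ → ℝ) (hw_nonneg : ∀ z, 0 ≤ w z)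
    (hw_ne : ¬ w =ᵐ[volume] 0)
    (hw_moments : ∀ k ≤ 2 * (M + n - 1), Integrable (fun z : ℝ => z ^ k * w z))
    (x y : Fin n → ℂ) (hx : ∀ i, x i ≠ 0) (hy : ∀ i, y i ≠ 0)
    (hxi : Function.Injective x) (hyi : Function.Injective y) :
    hatKernel w (M + n) x y = ∑ l ∈ boundedPartitions (2 * n) M,
      schur l (tVec x y) * ((ensembleAverage w M fun z => schur l.transpose z : ℝ) : ℂ) := by
  have hpos := fun k hk =>
    (orthoPoly_orthogonal w (M + n) hw_nonneg hw_ne hw_moments k hk).1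
  have hZ : ((M.factorial : ℝ) * partitionFn w M : ℝ) =
      M.factorial * ∏ j ∈ Finset.range M, sqNorm w j :=
    factorial_mul_partitionFn w hw_nonneg hw_ne fun k hk => hw_moments k (by omega)
  have havg : ∀ l : YoungDiagram, ((ensembleAverage w M fun z => schur l.transpose z : ℝ) : ℂ) =
      1 / (M.factorial * ∏ j ∈ Finset.range M, (sqNorm w j : ℂ)) *
        ∫ z : Fin M → ℝ, vdm (fun k => (z k : ℂ)) ^ 2 *
          schur l.transpose (fun k => (z k : ℂ)) * ∏ k, (w (z k) : ℂ) := by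
    intro l
    rw [ensembleAverage, hZ, Complex.ofReal_mul, ← integral_complex_ofReal]
    push_cast
    have hs : ∀ z : Fin M → ℝ, ((schur l.transpose z : ℝ) : ℂ) =
      schur l.transpose (fun k => (z k : ℂ)) := fun z => map_schur Complex.ofRealHom _ z
    simp only [hs, vdm_ofReal]
  have hexp : ∀ z : Fin M → ℝ, ((∏ i, ∏ k, (x i - z k)) * ∏ i, ∏ k, (y i - z k)) =
      (∏ i, (x i * y i) ^ M) * ∑ l ∈ boundedPartitions (2 * n) M,
        schur l (tVec x y) * schur l.transpose (fun k => (z k : ℂ)) := by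
    intro z
    have hne : ∏ i, (x i * y i) ^ M ≠ 0 :=
      Finset.prod_ne_zero_iff.2 fun i _ => pow_ne_zero _ (mul_ne_zero (hx i) (hy i))
    rw [two_mul, ← prod_one_add_mul_eq_sum_schur, prod_tVec x y hx hy, mul_div_cancel₀ _ hne]
  have hsum : ∫ z : Fin M → ℝ, vdm (fun k => (z k : ℂ)) ^ 2 *
        ((∏ i, ∏ k, (x i - z k)) * ∏ i, ∏ k, (y i - z k)) * ∏ k, (w (z k) : ℂ) =
      (∏ i, (x i * y i) ^ M) * ∑ l ∈ boundedPartitions (2 * n) M, schur l (tVec x y) *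
        ∫ z : Fin M → ℝ, vdm (fun k => (z k : ℂ)) ^ 2 *
          schur l.transpose (fun k => (z k : ℂ)) * ∏ k, (w (z k) : ℂ) := by
    simp only [← integral_const_mul]
    rw [← integral_finsetSum, ← integral_const_mul]
    · refine integral_congr_ae (.of_forall fun z => ?_)
      simp only [hexp, Finset.mul_sum, Finset.sum_mul]
      exact Finset.sum_congr rfl fun l _ => by ring
    · intro l hl
      obtain ⟨h1, h2⟩ := mem_boundedPartitions.1 hl
      exact (integrable_vdm_sq_mul_schur w hw_moments l.transpose (by simpa using h2)
        (by simpa using h1)).const_mul _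
  have hmain := vdm_mul_vdm_mul_integral w hw_nonneg hw_ne hw_moments x y
  rw [hsum, ← Finset.prod_range_mul_prod_Ico _ (Nat.le_add_right M n)] at hmain
  simp only [havg, hatKernel, multiKernel, Nat.add_sub_cancel]
  have hvx := vdm_ne_zero hxi
  have hvy := vdm_ne_zero hyi
  have hne : ∏ i, (x i * y i) ^ M ≠ 0 :=
    Finset.prod_ne_zero_iff.2 fun i _ => pow_ne_zero _ (mul_ne_zero (hx i) (hy i))
  have hM : (M.factorial : ℂ) ≠ 0 := by exact_mod_cast M.factorial_ne_zero
  have hP : ∏ j ∈ Finset.range M, (sqNorm w j : ℂ) ≠ 0 :=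
    Finset.prod_ne_zero_iff.2 fun j hj => Complex.ofReal_ne_zero.2
      (hpos j (by have := Finset.mem_range.1 hj; omega)).ne'
  simp only [mul_left_comm (schur _ (tVec x y))]
  rw [← Finset.mul_sum]
  generalize (∑ l ∈ boundedPartitions (2 * n) M, schur l (tVec x y) *
    ∫ z : Fin M → ℝ, vdm (fun k => (z k : ℂ)) ^ 2 *
      schur l.transpose (fun k => (z k : ℂ)) * ∏ k, (w (z k) : ℂ)) = S at hmain ⊢
  field_simp
  linear_combination -hmain

end Kernel

/-! ### Distinct and coinciding points -/

theorem continuousAt_schur_tVec {n : ℕ} (l : YoungDiagram) (x y : Fin n → ℂ) (hx : ∀ i, x i ≠ 0)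
    (hy : ∀ i, y i ≠ 0) :
    ContinuousAt (fun p : (Fin n → ℂ) × (Fin n → ℂ) => schur l (tVec p.1 p.2)) (x, y) := by
  have h1 : Continuous fun t : Fin (n + n) → ℂ => schur l t := by
    unfold schur
    simp only [MvPolynomial.aeval_def, ← MvPolynomial.eval_map]
    exact MvPolynomial.continuous_eval _
  refine h1.continuousAt.comp (continuousAt_pi.2 fun i => ?_)
  refine Fin.addCases (fun i => ?_) (fun i => ?_) i
  · simp only [tVec, Fin.append_left]
    exact ContinuousAt.div continuousAt_const (by fun_prop) (hx i)
  · simp only [tVec, Fin.append_right]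
    exact ContinuousAt.div continuousAt_const (by fun_prop) (hy i)

end CDSchur

theorem theorem2p1 (w : ℝ → ℝ) (N n : ℕ) (hn : n ≤ N)
    (hw_nonneg : ∀ z, 0 ≤ w z)
    (hw_ne : ¬ w =ᵐ[volume] 0)
    (hw_moments : ∀ k ≤ 2 * (N - 1), Integrable (fun z : ℝ => z ^ k * w z))
    (x y : Fin n → ℂ) (hx : ∀ i, x i ≠ 0) (hy : ∀ i, y i ≠ 0) :
    (Function.Injective x → Function.Injective y →
      hatKernel w N x y =
        ∑ l ∈ boundedPartitions (2 * n) (N - n),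
          schur l (tVec x y) *
            ((ensembleAverage w (N - n) fun z => schur l.transpose z : ℝ) : ℂ)) ∧
    Tendsto (fun p : (Fin n → ℂ) × (Fin n → ℂ) => hatKernel w N p.1 p.2)
      (𝓝[{p | Function.Injective p.1 ∧ Function.Injective p.2}] (x, y))
      (𝓝 (∑ l ∈ boundedPartitions (2 * n) (N - n),
          schur l (tVec x y) *
            ((ensembleAverage w (N - n) fun z => schur l.transpose z : ℝ) : ℂ))) := by
  obtain ⟨M, rfl⟩ : ∃ M, N = M + n := ⟨N - n, by omega⟩
  rw [Nat.add_sub_cancel]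
  refine ⟨hatKernel_eq_sum_schur w hw_nonneg hw_ne hw_moments x y hx hy, ?_⟩
  have hcont : ContinuousAt (fun p : (Fin n → ℂ) × (Fin n → ℂ) =>
      ∑ l ∈ boundedPartitions (2 * n) M, schur l (tVec p.1 p.2) *
        ((ensembleAverage w M fun z => schur l.transpose z : ℝ) : ℂ)) (x, y) :=
    tendsto_finsetSum _ fun l _ => (continuousAt_schur_tVec l x y hx hy).mul continuousAt_const
  refine (hcont.tendsto.mono_left nhdsWithin_le_nhds).congr' ?_
  have hne : ∀ᶠ p : (Fin n → ℂ) × (Fin n → ℂ) in 𝓝 (x, y),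
      (∀ i, p.1 i ≠ 0) ∧ ∀ i, p.2 i ≠ 0 := by
    refine (eventually_all.2 fun i => ?_).and (eventually_all.2 fun i => ?_)
    · exact ContinuousAt.eventually_ne (g := fun p : (Fin n → ℂ) × (Fin n → ℂ) => p.1 i)
        (by fun_prop) (hx i)
    · exact ContinuousAt.eventually_ne (g := fun p : (Fin n → ℂ) × (Fin n → ℂ) => p.2 i)
        (by fun_prop) (hy i)
  filter_upwards [self_mem_nhdsWithin, nhdsWithin_le_nhds hne] with p hp hp0
  exact (hatKernel_eq_sum_schur w hw_nonneg hw_ne hw_moments p.1 p.2 hp0.1 hp0.2 hp.1 hp.2).symm
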